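/- Let $n\in\mathbb N$, let $\Omega\subset\mathbb R^n$ be open and connected, let $F\in C^1(\Omega,\mathbb R^n)$, and let $\phi(t,z)$ be the local flow of $\dot z=F(z)$ in $\Omega$: $\phi(t,z)$ is the value at time $t$ of the solution in $\Omega$ that starts at $z$ at time $0$, for all $t$ (positive or negative) up to which this solution exists. Put $\Delta_0=\{z\in\Omega:\operatorname{div}F(z)=0\}$. Let $\sigma:\Omega\to\Omega$ be a $C^1$ map such that - $\sigma(\sigma(z))=z$ for all $z\in\Omega$ ($\sigma$ is an involution); - $\phi(t,\sigma(z))=\sigma(\phi(-t,z))$ for all $t\in\mathbb R$ and $z\in\Omega$ such that both sides are defined ($\sigma$ is a reversibility of $\dot z=F(z)$); - $\mu(\sigma(A))=\mu(A)$ for every measurable set $A\subset\Omega$, where $\mu$ is the Lebesgue measure ($\sigma$ is measure-preserving). Then: (i) if $z\in\Omega$ and $t_z\in\mathbb R$ are such that $\phi(t_z,z)$ is defined and $\sigma(z)=\phi(t_z,z)\neq z$, then the arc of orbit $\{\phi(s,z): s \text{ between } 0 \text{ and } t_z\}$ connecting $z$ to $\sigma(z)$ contains a point of $\Delta_0$;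 (ii) if $z\in\Omega$ satisfies $\sigma(z)=z$ and $F(z)\neq 0$, then $z\in\Delta_0$. -/

import Mathlib

open Set MeasureTheory

section Flow

variable {E : Type*} [NormedAddCommGroup E] [NormedSpace ℝ E]

/-- `γ` is a solution of `ż = F z` with `γ 0 = z`, staying in `Ω`, on the closed interval with
end points `0` and `t` (`t` may be negative; one-sided derivatives at the end points). -/
structure IsSolutionFrom (F : E → E) (Ω : Set E) (z : E) (t : ℝ) (γ : ℝ → E) : Prop where
  initial : γ 0 = z
  mapsTo : MapsTo γ (uIcc 0 t) Ω
  isIntegralCurveOn : IsIntegralCurveOn γ (fun _ => F) (uIcc 0 t)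

/-- The domain of the local flow of `ż = F z` in `Ω`: all `(t, z)` such that the solution starting
at `z` exists in `Ω` up to time `t`. -/
def flowDomain (F : E → E) (Ω : Set E) : Set (ℝ × E) :=
  {p | ∃ γ : ℝ → E, IsSolutionFrom F Ω p.2 p.1 γ}

open Classical in
/-- The local flow `φ(t, z)` of `ż = F z` in `Ω`: the value at time `t` of the solution starting at
`z` if `(t, z)` is in `flowDomain F Ω` (and, by convention, `z` otherwise). -/
noncomputable def localFlow (F : E → E) (Ω : Set E) (t : ℝ) (z : E) : E :=
  if h : ∃ γ : ℝ → E, IsSolutionFrom F Ω z t γ then h.choose t else z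

lemma IsSolutionFrom.neg {F : E → E} {Ω : Set E} {z : E} {t : ℝ} {γ : ℝ → E}
    (h : IsSolutionFrom F Ω z t γ) : IsSolutionFrom (-F) Ω z (-t) (fun s => γ (-s)) := by
  have hm : MapsTo (fun s : ℝ => -s) (uIcc 0 (-t)) (uIcc 0 t) := by
    intro s hs
    rw [mem_uIcc] at hs ⊢
    rcases hs with hs | hs
    · right; constructor <;> linarith [hs.1, hs.2]
    · left; constructor <;> linarith [hs.1, hs.2]
  refine ⟨by simpa using h.initial, fun s hs => h.mapsTo (hm hs), fun s hs => ?_⟩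
  have := (h.isIntegralCurveOn (-s) (hm hs)).scomp s (hasDerivAt_neg s).hasDerivWithinAt hm
  simpa [Function.comp_def] using this

/-- Solutions of a `C¹` system are unique. -/
theorem IsSolutionFrom.eq {F : E → E} {Ω : Set E} (hΩ : IsOpen Ω) (hF : ContDiffOn ℝ 1 F Ω)
    {z : E} {t : ℝ} {γ₁ γ₂ : ℝ → E} (h₁ : IsSolutionFrom F Ω z t γ₁)
    (h₂ : IsSolutionFrom F Ω z t γ₂) : γ₁ t = γ₂ t := by
  wlog ht : 0 ≤ t generalizing F t γ₁ γ₂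
  · simpa using this hF.neg h₁.neg h₂.neg (by linarith)
  have hI : uIcc 0 t = Icc 0 t := uIcc_of_le ht
  have hc₁ : ContinuousOn γ₁ (Icc 0 t) := hI ▸ h₁.isIntegralCurveOn.continuousOn
  have hc₂ : ContinuousOn γ₂ (Icc 0 t) := hI ▸ h₂.isIntegralCurveOn.continuousOn
  have hm₁ : MapsTo γ₁ (Icc 0 t) Ω := hI ▸ h₁.mapsTo
  have hm₂ : MapsTo γ₂ (Icc 0 t) Ω := hI ▸ h₂.mapsTo
  have hi₁ : IsIntegralCurveOn γ₁ (fun _ => F) (Icc 0 t) := hI ▸ h₁.isIntegralCurveOn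
  have hi₂ : IsIntegralCurveOn γ₂ (fun _ => F) (Icc 0 t) := hI ▸ h₂.isIntegralCurveOn
  have hK : IsCompact (γ₁ '' Icc 0 t ∪ γ₂ '' Icc 0 t) :=
    (isCompact_Icc.image_of_continuousOn hc₁).union (isCompact_Icc.image_of_continuousOn hc₂)
  have hKΩ : γ₁ '' Icc 0 t ∪ γ₂ '' Icc 0 t ⊆ Ω := union_subset hm₁.image_subset hm₂.image_subset
  have hloc : LocallyLipschitzOn (γ₁ '' Icc 0 t ∪ γ₂ '' Icc 0 t) F := by
    intro x hx
    obtain ⟨K, s, hs, hL⟩ :=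
      (hF.contDiffAt (hΩ.mem_nhds (hKΩ hx))).exists_lipschitzOnWith
    exact ⟨K, s, mem_nhdsWithin_of_mem_nhds hs, hL⟩
  obtain ⟨K, hL⟩ := hloc.exists_lipschitzOnWith_of_compact hK
  have hd : ∀ {γ : ℝ → E}, IsIntegralCurveOn γ (fun _ => F) (Icc 0 t) →
      ∀ s ∈ Ico 0 t, HasDerivWithinAt γ (F (γ s)) (Ici s) s := fun h s hs =>
    (h s (Ico_subset_Icc_self hs)).mono_of_mem_nhdsWithin
      (Filter.mem_of_superset (Icc_mem_nhdsGE hs.2) (Icc_subset_Icc_left hs.1))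
  exact ODE_solution_unique_of_mem_Icc_right (v := fun _ => F)
    (s := fun _ => γ₁ '' Icc 0 t ∪ γ₂ '' Icc 0 t) (fun _ _ => hL) hc₁ (hd hi₁)
    (fun s hs => Or.inl (mem_image_of_mem _ (Ico_subset_Icc_self hs))) hc₂ (hd hi₂)
    (fun s hs => Or.inr (mem_image_of_mem _ (Ico_subset_Icc_self hs)))
    (h₁.initial.trans h₂.initial.symm) (right_mem_Icc.2 ht)

/-- The local flow of a `C¹` system is well defined: it is the value at time `t` of any solution
starting at `z`. -/
theorem localFlow_eq {F : E → E} {Ω : Set E} (hΩ : IsOpen Ω) (hF : ContDiffOn ℝ 1 F Ω)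
    {z : E} {t : ℝ} {γ : ℝ → E} (h : IsSolutionFrom F Ω z t γ) : localFlow F Ω t z = γ t := by
  have hex : ∃ γ : ℝ → E, IsSolutionFrom F Ω z t γ := ⟨γ, h⟩
  rw [localFlow, dif_pos hex]
  exact hex.choose_spec.eq hΩ hF h

/-- A `C¹` involution of `Ω` (hence a `C¹` diffeomorphism of `Ω` onto itself). -/
structure IsC1Involution (σ : E → E) (Ω : Set E) : Prop where
  contDiffOn : ContDiffOn ℝ 1 σ Ω
  mapsTo : MapsTo σ Ω Ω
  involutive : ∀ z ∈ Ω, σ (σ z) = z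

/-- The involution `σ` is a reversibility of `ż = F z` in `Ω`: `φ(t, σ z) = σ (φ(-t, z))` whenever
both sides are defined. -/
structure IsReversibility (σ F : E → E) (Ω : Set E) : Prop extends IsC1Involution σ Ω where
  reverses : ∀ t : ℝ, ∀ z ∈ Ω, (t, σ z) ∈ flowDomain F Ω → (-t, z) ∈ flowDomain F Ω →
    localFlow F Ω t (σ z) = σ (localFlow F Ω (-t) z)

/-- The arc of orbit of `z` between the times `0` and `t`. -/
def orbitArc (F : E → E) (Ω : Set E) (t : ℝ) (z : E) : Set E :=
  (fun s => localFlow F Ω s z) '' uIcc 0 t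

end Flow

section Euclidean

variable {n : ℕ}

/-- `σ` preserves the Lebesgue measure of the measurable subsets of `Ω`. -/
def IsMeasurePreservingOn (σ : EuclideanSpace ℝ (Fin n) → EuclideanSpace ℝ (Fin n))
    (Ω : Set (EuclideanSpace ℝ (Fin n))) : Prop :=
  ∀ A ⊆ Ω, MeasurableSet A → volume (σ '' A) = volume A

/-- The divergence `∑ i, ∂F_i/∂z_i`. -/
noncomputable def divergence (F : EuclideanSpace ℝ (Fin n) → EuclideanSpace ℝ (Fin n))
    (z : EuclideanSpace ℝ (Fin n)) : ℝ :=
  ∑ i, fderiv ℝ F z (EuclideanSpace.single i 1) i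

/-- The set of the points of `Ω` where the divergence of `F` vanishes. -/
def zeroDivergenceSet (F : EuclideanSpace ℝ (Fin n) → EuclideanSpace ℝ (Fin n))
    (Ω : Set (EuclideanSpace ℝ (Fin n))) : Set (EuclideanSpace ℝ (Fin n)) :=
  {z ∈ Ω | divergence F z = 0}

end Euclidean

/-! Differentiating the reversibility at time zero gives `Dσ(F) = -F ∘ σ`, so `σ` carries `F` to
`-F`. The divergence depends only on the field and the volume, and `σ` preserves volume, hence `div
F ∘ σ = -div F` on `Ω`. At a fixed point this forces `div F = 0`; on an arc from `z` to `σ z` the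
divergence takes opposite values at the ends, and the intermediate value theorem applies.

As `σ` is only `C¹`, the relation `Dσ(F) = -F ∘ σ` cannot be differentiated again term by term. The
divergence identity is therefore proved weakly, against test functions
(`IsReversibility.integral_divergence_comp_mul`), and then pointwise by continuity of `div F`
(`IsReversibility.divergence_apply`). -/

section Reversibility

/-! ### Infinitesimal reversibility and transport of test functions -/

open Filter Topology

variable {E : Type*} [NormedAddCommGroup E] [NormedSpace ℝ E]

/-- The local flow at times up to `t` is given by any solution up to time `t`. -/
lemma IsSolutionFrom.localFlow_eqOn {F : E → E} {Ω : Set E} (hΩ : IsOpen Ω)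
    (hF : ContDiffOn ℝ 1 F Ω) {z : E} {t : ℝ} {γ : ℝ → E} (h : IsSolutionFrom F Ω z t γ) :
    EqOn (fun s => localFlow F Ω s z) γ (uIcc 0 t) := by
  intro s hs
  have hsub : uIcc 0 s ⊆ uIcc 0 t := uIcc_subset_uIcc left_mem_uIcc hs
  exact localFlow_eq hΩ hF ⟨h.initial, h.mapsTo.mono_left hsub, h.isIntegralCurveOn.mono hsub⟩

/-- Solutions exist up to all small times, and are differentiable at time `0`. -/
lemma exists_eventually_isSolutionFrom [CompleteSpace E] {F : E → E} {Ω : Set E}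
    (hΩ : IsOpen Ω) (hF : ContDiffOn ℝ 1 F Ω) {z : E} (hz : z ∈ Ω) :
    ∃ γ : ℝ → E, HasDerivAt γ (F z) 0 ∧ γ 0 = z ∧ ∀ᶠ t in 𝓝 (0 : ℝ), IsSolutionFrom F Ω z t γ := by
  obtain ⟨γ, h0, ε, hε, hγ⟩ := (hF.contDiffAt (hΩ.mem_nhds hz)
    ).exists_forall_mem_closedBall_exists_eq_forall_mem_Ioo_hasDerivAt₀ 0
  have hd : HasDerivAt γ (F z) 0 := h0 ▸ hγ 0 (by constructor <;> linarith)
  have hmem : ∀ᶠ t in 𝓝 (0 : ℝ), γ t ∈ Ω :=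
    hd.continuousAt.eventually (by rw [h0]; exact hΩ.mem_nhds hz)
  obtain ⟨δ, hδ, hball⟩ := Metric.eventually_nhds_iff_ball.1
    (hmem.and (Ioo_mem_nhds (show 0 - ε < 0 by linarith) (show 0 < 0 + ε by linarith)))
  refine ⟨γ, hd, h0, ?_⟩
  filter_upwards [Metric.ball_mem_nhds (0 : ℝ) hδ] with t ht
  have hsub : uIcc 0 t ⊆ Metric.ball 0 δ :=
    ((convex_ball (0 : ℝ) δ).ordConnected).uIcc_subset (Metric.mem_ball_self hδ) ht
  exact ⟨h0, fun s hs => (hball s (hsub hs)).1,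
    fun s hs => (hγ s (hball s (hsub hs)).2).hasDerivWithinAt⟩

/-- A reversibility maps the vector field to its opposite. -/
lemma IsReversibility.fderiv_apply [CompleteSpace E] {σ F : E → E} {Ω : Set E}
    (hσ : IsReversibility σ F Ω) (hΩ : IsOpen Ω) (hF : ContDiffOn ℝ 1 F Ω) {z : E} (hz : z ∈ Ω) :
    fderiv ℝ σ z (F z) = -F (σ z) := by
  obtain ⟨γ, hγd, hγ0, hγ⟩ := exists_eventually_isSolutionFrom hΩ hF hz
  obtain ⟨η, hηd, hη0, hη⟩ := exists_eventually_isSolutionFrom hΩ hF (hσ.mapsTo hz)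
  have hneg : Tendsto (fun t : ℝ => -t) (𝓝 0) (𝓝 0) := by
    simpa using (continuous_neg (G := ℝ)).tendsto 0
  have heq : (fun t => η (-t)) =ᶠ[𝓝 0] σ ∘ γ := by
    filter_upwards [hγ, hneg.eventually hη] with t h₁ h₂
    have h₁' : IsSolutionFrom F Ω z (- -t) γ := by rwa [neg_neg]
    have := hσ.reverses (-t) z hz ⟨η, h₂⟩ ⟨γ, h₁'⟩
    rw [localFlow_eq hΩ hF h₂, localFlow_eq hΩ hF h₁'] at this
    simpa using this
  have hσd : HasFDerivAt σ (fderiv ℝ σ z) (γ 0) := by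
    rw [hγ0]
    exact ((hσ.contDiffOn.contDiffAt (hΩ.mem_nhds hz)).differentiableAt one_ne_zero).hasFDerivAt
  have h₁ : HasDerivAt (σ ∘ γ) (fderiv ℝ σ z (F z)) 0 := hσd.comp_hasDerivAt 0 hγd
  have h₂ : HasDerivAt (fun t => η (-t)) (-F (σ z)) 0 := by
    have : HasDerivAt η (F (σ z)) (-0) := by simpa using hηd
    simpa [Function.comp_def] using this.scomp 0 (hasDerivAt_neg (0 : ℝ))
  exact (h₁.congr_of_eventuallyEq heq).unique h₂

/-- The composition of a compactly supported `C¹` function with a `C¹` involution of `Ω`,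
extended by zero, is `C¹` with compact support in `Ω`. -/
lemma IsC1Involution.indicator_comp {σ : E → E} {Ω : Set E} (hσ : IsC1Involution σ Ω)
    (hΩ : IsOpen Ω) {g : E → ℝ} (hg : ContDiff ℝ 1 g) (hgc : HasCompactSupport g)
    (hgΩ : tsupport g ⊆ Ω) :
    ContDiff ℝ 1 (Ω.indicator (g ∘ σ)) ∧ HasCompactSupport (Ω.indicator (g ∘ σ)) ∧
      tsupport (Ω.indicator (g ∘ σ)) ⊆ Ω := by
  have hK : IsCompact (σ '' tsupport g) :=
    hgc.isCompact.image_of_continuousOn (hσ.contDiffOn.continuousOn.mono hgΩ)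
  have hKΩ : σ '' tsupport g ⊆ Ω := (hσ.mapsTo.mono_left hgΩ).image_subset
  -- The support lies in a compact subset of `Ω`, so the extension by zero creates no singularity at
  -- the boundary of `Ω`.
  have hsupp : tsupport (Ω.indicator (g ∘ σ)) ⊆ σ '' tsupport g := by
    refine closure_minimal (fun z hz => ?_) hK.isClosed
    have hzΩ : z ∈ Ω := mem_of_indicator_ne_zero hz
    rw [Function.mem_support, indicator_of_mem hzΩ] at hz
    exact ⟨σ z, subset_tsupport g hz, hσ.involutive z hzΩ⟩
  refine ⟨contDiff_iff_contDiffAt.2 fun z => ?_, hK.of_isClosed_subset (isClosed_tsupport _) hsupp,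
    hsupp.trans hKΩ⟩
  by_cases hz : z ∈ tsupport (Ω.indicator (g ∘ σ))
  swap
  · exact contDiffAt_const.congr_of_eventuallyEq (notMem_tsupport_iff_eventuallyEq.1 hz)
  have hzΩ : Ω ∈ 𝓝 z := hΩ.mem_nhds (hKΩ (hsupp hz))
  refine ContDiffAt.congr_of_eventuallyEq
    (hg.contDiffAt.comp z (hσ.contDiffOn.contDiffAt hzΩ)) ?_
  filter_upwards [hzΩ] with w hw using indicator_of_mem hw _

end Reversibility

/-! ### Weak divergence and its change of sign under `σ` -/

section Divergence

variable {n : ℕ}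

/-- Nothing is known of `f` off `Ω`, but the product vanishes off the compact set `tsupport g`,
where both factors are continuous. -/
lemma integrable_mul_of_tsupport_subset {E : Type*} [TopologicalSpace E] [T2Space E]
    [MeasurableSpace E] [OpensMeasurableSpace E] {μ : Measure E} [IsFiniteMeasureOnCompacts μ]
    {Ω : Set E} {f g : E → ℝ} (hf : ContinuousOn f Ω) (hg : Continuous g)
    (hgc : HasCompactSupport g) (hgΩ : tsupport g ⊆ Ω) : Integrable (fun z => f z * g z) μ := by
  have hs : Function.support (fun z => f z * g z) ⊆ tsupport g := fun z hz =>
    subset_tsupport g (right_ne_zero_of_mul hz)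
  rw [← integrableOn_iff_integrable_of_support_subset hs]
  exact ((hf.mono hgΩ).mul hg.continuousOn).integrableOn_compact' hgc.isCompact
    hgc.isCompact.measurableSet

lemma ContDiffOn.continuousOn_divergence
    {F : EuclideanSpace ℝ (Fin n) → EuclideanSpace ℝ (Fin n)} {Ω : Set (EuclideanSpace ℝ (Fin n))}
    (hF : ContDiffOn ℝ 1 F Ω) (hΩ : IsOpen Ω) : ContinuousOn (divergence F) Ω := by
  have h := hF.continuousOn_fderiv_of_isOpen hΩ le_rfl
  refine continuousOn_finsetSum _ fun i _ => ?_
  exact (EuclideanSpace.proj (𝕜 := ℝ) i).continuous.comp_continuousOn (h.clm_apply continuousOn_const)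

/-- Integration by parts: the weak form of the divergence. -/
lemma integral_divergence_mul
    {F : EuclideanSpace ℝ (Fin n) → EuclideanSpace ℝ (Fin n)} {Ω : Set (EuclideanSpace ℝ (Fin n))}
    (hΩ : IsOpen Ω) (hF : ContDiffOn ℝ 1 F Ω) {g : EuclideanSpace ℝ (Fin n) → ℝ}
    (hg : ContDiff ℝ 1 g) (hgc : HasCompactSupport g) (hgΩ : tsupport g ⊆ Ω) :
    ∫ z, divergence F z * g z = -∫ z, fderiv ℝ g z (F z) := by
  have hcoord : ∀ i, ContDiffOn ℝ 1 (fun z => F z i) Ω := fun i =>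
    (EuclideanSpace.proj (𝕜 := ℝ) i).contDiff.comp_contDiffOn hF
  have hfd : ∀ i, ∀ z ∈ Ω, ∀ v, fderiv ℝ (fun z => F z i) z v = fderiv ℝ F z v i := by
    intro i z hz v
    have h := ((hF.contDiffAt (hΩ.mem_nhds hz)).differentiableAt one_ne_zero).hasFDerivAt
    exact congrArg (fun L => L v)
      ((EuclideanSpace.proj (𝕜 := ℝ) i).hasFDerivAt.comp z h).fderiv
  have hdg : ∀ v, Continuous fun z => fderiv ℝ g z v := fun v =>
    (hg.continuous_fderiv one_ne_zero).clm_apply continuous_const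
  have hI₁ : ∀ i, Integrable fun z => fderiv ℝ F z (EuclideanSpace.single i 1) i * g z := fun i =>
    integrable_mul_of_tsupport_subset ((EuclideanSpace.proj (𝕜 := ℝ) i).continuous.comp_continuousOn
      ((hF.continuousOn_fderiv_of_isOpen hΩ le_rfl).clm_apply continuousOn_const))
      hg.continuous hgc hgΩ
  have hI₂ : ∀ i, Integrable fun z => F z i * fderiv ℝ g z (EuclideanSpace.single i 1) := fun i =>
    integrable_mul_of_tsupport_subset (hcoord i).continuousOn (hdg _)
      (hgc.fderiv_apply (𝕜 := ℝ) _) ((tsupport_fderiv_apply_subset ℝ _).trans hgΩ)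
  have hI₃ : ∀ i, Integrable fun z => F z i * g z := fun i =>
    integrable_mul_of_tsupport_subset (hcoord i).continuousOn hg.continuous hgc hgΩ
  -- Coordinates commute with `fderiv` only where `F` is known to be differentiable; elsewhere the
  -- factor `g z` vanishes.
  have hswap : ∀ i z, fderiv ℝ (fun z => F z i) z (EuclideanSpace.single i 1) * g z
      = fderiv ℝ F z (EuclideanSpace.single i 1) i * g z := by
    intro i z
    by_cases hz : z ∈ tsupport g
    · rw [hfd i z (hgΩ hz)]
    · simp [image_eq_zero_of_notMem_tsupport hz]
  have hparts : ∀ i, ∫ z, fderiv ℝ F z (EuclideanSpace.single i 1) i * g z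
      = -∫ z, F z i * fderiv ℝ g z (EuclideanSpace.single i 1) := by
    intro i
    have hpw : (fun z => g z * fderiv ℝ (fun z => F z i) z (EuclideanSpace.single i 1))
        = fun z => fderiv ℝ F z (EuclideanSpace.single i 1) i * g z := by
      funext z; rw [mul_comm, hswap]
    have h := integral_mul_fderiv_eq_neg_fderiv_mul_of_integrable (μ := volume)
      (f := g) (g := fun z => F z i) (v := EuclideanSpace.single i (1 : ℝ))
      (by simpa only [mul_comm] using hI₂ i) (by rw [hpw]; exact hI₁ i)
      (by simpa only [mul_comm] using hI₃ i)
      (fun z _ => hg.differentiable one_ne_zero z)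
      (fun z hz => ((hcoord i).contDiffAt (hΩ.mem_nhds (hgΩ hz))).differentiableAt one_ne_zero)
    rw [hpw] at h
    rw [h]
    simp only [mul_comm]
  have hexp : ∀ z, fderiv ℝ g z (F z) = ∑ i, F z i * fderiv ℝ g z (EuclideanSpace.single i 1) := by
    intro z
    conv_lhs => rw [← (EuclideanSpace.basisFun (Fin n) ℝ).sum_repr (F z)]
    simp
  simp only [divergence, Finset.sum_mul, hexp]
  rw [integral_finsetSum _ fun i _ => hI₁ i, integral_finsetSum _ fun i _ => hI₂ i,
    ← Finset.sum_neg_distrib]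
  exact Finset.sum_congr rfl fun i _ => hparts i

/-- An involution of `Ω` preserving the measure of the subsets of `Ω` preserves the restriction of
the Lebesgue measure to `Ω`. -/
lemma IsMeasurePreservingOn.map_restrict
    {σ : EuclideanSpace ℝ (Fin n) → EuclideanSpace ℝ (Fin n)} {Ω : Set (EuclideanSpace ℝ (Fin n))}
    (hμ : IsMeasurePreservingOn σ Ω) (hσ : IsC1Involution σ Ω) (hΩ : IsOpen Ω) :
    (volume.restrict Ω).map σ = volume.restrict Ω := by
  have hc := hσ.contDiffOn.continuousOn
  ext s hs
  rw [Measure.map_apply_of_aemeasurable (hc.aemeasurable hΩ.measurableSet) hs,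
    Measure.restrict_apply' hΩ.measurableSet, Measure.restrict_apply' hΩ.measurableSet]
  have hm : MeasurableSet (σ ⁻¹' s ∩ Ω) := by
    have := measurable_of_isOpen (f := Ω.domRestrict σ) fun u hu =>
      (hu.preimage hc.domRestrict).measurableSet
    have h := (MeasurableEmbedding.subtype_coe hΩ.measurableSet).measurableSet_image.2 (this hs)
    rwa [domRestrict_eq, preimage_comp, Subtype.image_preimage_coe, inter_comm] at h
  -- The hypothesis concerns images, the pushforward preimages; for an involution of `Ω` they agree.
  rw [← hμ _ inter_subset_right hm]
  congr 1
  ext w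
  constructor
  · rintro ⟨z, ⟨hzs, hzΩ⟩, rfl⟩
    exact ⟨hzs, hσ.mapsTo hzΩ⟩
  · rintro ⟨hws, hwΩ⟩
    exact ⟨σ w, ⟨by rwa [mem_preimage, hσ.involutive w hwΩ], hσ.mapsTo hwΩ⟩, hσ.involutive w hwΩ⟩

/-- Integrability plays no role: integrating against a pushforward requires only measurability. -/
lemma IsMeasurePreservingOn.setIntegral_comp
    {σ : EuclideanSpace ℝ (Fin n) → EuclideanSpace ℝ (Fin n)} {Ω : Set (EuclideanSpace ℝ (Fin n))}
    (hμ : IsMeasurePreservingOn σ Ω) (hσ : IsC1Involution σ Ω) (hΩ : IsOpen Ω)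
    {f : EuclideanSpace ℝ (Fin n) → ℝ} (hf : ContinuousOn f Ω) :
    ∫ z in Ω, f (σ z) = ∫ z in Ω, f z := by
  conv_rhs => rw [← hμ.map_restrict hσ hΩ]
  refine (integral_map (hσ.contDiffOn.continuousOn.aemeasurable hΩ.measurableSet) ?_).symm
  rw [hμ.map_restrict hσ hΩ]
  exact hf.aestronglyMeasurable hΩ.measurableSet

/-- A measure preserving reversibility changes the sign of the divergence, in the weak sense. -/
lemma IsReversibility.integral_divergence_comp_mul
    {σ F : EuclideanSpace ℝ (Fin n) → EuclideanSpace ℝ (Fin n)}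
    {Ω : Set (EuclideanSpace ℝ (Fin n))} (hσ : IsReversibility σ F Ω) (hΩ : IsOpen Ω)
    (hF : ContDiffOn ℝ 1 F Ω) (hμ : IsMeasurePreservingOn σ Ω)
    {g : EuclideanSpace ℝ (Fin n) → ℝ} (hg : ContDiff ℝ 1 g) (hgc : HasCompactSupport g)
    (hgΩ : tsupport g ⊆ Ω) :
    ∫ z, divergence F (σ z) * g z = -∫ z, divergence F z * g z := by
  have hσ' := hσ.toIsC1Involution
  have hc := hσ'.contDiffOn.continuousOn
  obtain ⟨hG, hGc, hGΩ⟩ := hσ'.indicator_comp hΩ hg hgc hgΩ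
  set G := Ω.indicator (g ∘ σ) with hGdef
  have hg0 : ∀ z ∉ Ω, g z = 0 := fun z hz =>
    image_eq_zero_of_notMem_tsupport fun h => hz (hgΩ h)
  have hfd0 : ∀ {k : EuclideanSpace ℝ (Fin n) → ℝ}, tsupport k ⊆ Ω → ∀ z ∉ Ω,
      fderiv ℝ k z = 0 := fun hk z hz =>
    image_eq_zero_of_notMem_tsupport fun h => hz (hk (tsupport_fderiv_subset ℝ h))
  have hGfd : ∀ z ∈ Ω, fderiv ℝ G z (F z) = -fderiv ℝ g (σ z) (F (σ z)) := by
    intro z hz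
    have heq : G =ᶠ[nhds z] g ∘ σ := by
      filter_upwards [hΩ.mem_nhds hz] with w hw using indicator_of_mem hw _
    rw [heq.fderiv_eq, fderiv_comp z (hg.differentiable one_ne_zero _)
      ((hσ'.contDiffOn.contDiffAt (hΩ.mem_nhds hz)).differentiableAt one_ne_zero),
      ContinuousLinearMap.comp_apply, hσ.fderiv_apply hΩ hF hz, map_neg]
  -- A change of variables moves `σ` onto the test function; integrating by parts, using `hGfd`,
  -- changing variables back and integrating by parts again gives three sign changes.
  calc ∫ z, divergence F (σ z) * g z
      = ∫ z in Ω, divergence F (σ z) * g z :=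
        (setIntegral_eq_integral_of_forall_compl_eq_zero fun z hz => by
          rw [hg0 z hz, mul_zero]).symm
    _ = ∫ z in Ω, divergence F (σ z) * g (σ (σ z)) :=
        setIntegral_congr_fun hΩ.measurableSet fun z hz => by
          simp only [hσ'.involutive z hz]
    _ = ∫ z in Ω, divergence F z * g (σ z) :=
        hμ.setIntegral_comp hσ' hΩ (f := fun z => divergence F z * g (σ z))
          ((hF.continuousOn_divergence hΩ).mul (hg.continuous.comp_continuousOn hc))
    _ = ∫ z in Ω, divergence F z * G z :=
        setIntegral_congr_fun hΩ.measurableSet fun z hz => by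
          simp only [hGdef, indicator_of_mem hz, Function.comp_apply]
    _ = ∫ z, divergence F z * G z :=
        setIntegral_eq_integral_of_forall_compl_eq_zero fun z hz => by
          rw [hGdef, indicator_of_notMem hz, mul_zero]
    _ = -∫ z, fderiv ℝ G z (F z) := integral_divergence_mul hΩ hF hG hGc hGΩ
    _ = -∫ z in Ω, fderiv ℝ G z (F z) := by
        rw [setIntegral_eq_integral_of_forall_compl_eq_zero fun z hz => by
          rw [hfd0 hGΩ z hz, zero_apply]]
    _ = ∫ z in Ω, fderiv ℝ g (σ z) (F (σ z)) := by
        rw [setIntegral_congr_fun hΩ.measurableSet hGfd, integral_neg, neg_neg]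
    _ = ∫ z in Ω, fderiv ℝ g z (F z) :=
        hμ.setIntegral_comp hσ' hΩ (f := fun z => fderiv ℝ g z (F z))
          ((hg.continuous_fderiv one_ne_zero).continuousOn.clm_apply hF.continuousOn)
    _ = ∫ z, fderiv ℝ g z (F z) :=
        setIntegral_eq_integral_of_forall_compl_eq_zero fun z hz => by
          rw [hfd0 hgΩ z hz, zero_apply]
    _ = -∫ z, divergence F z * g z := by
        rw [integral_divergence_mul hΩ hF hg hgc hgΩ, neg_neg]

/-- A measure preserving reversibility changes the sign of the divergence. -/
theorem IsReversibility.divergence_apply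
    {σ F : EuclideanSpace ℝ (Fin n) → EuclideanSpace ℝ (Fin n)}
    {Ω : Set (EuclideanSpace ℝ (Fin n))} (hσ : IsReversibility σ F Ω) (hΩ : IsOpen Ω)
    (hF : ContDiffOn ℝ 1 F Ω) (hμ : IsMeasurePreservingOn σ Ω) {z : EuclideanSpace ℝ (Fin n)}
    (hz : z ∈ Ω) : divergence F (σ z) = -divergence F z := by
  have hd := hF.continuousOn_divergence hΩ
  have hdσ : ContinuousOn (fun z => divergence F (σ z)) Ω :=
    hd.comp hσ.contDiffOn.continuousOn hσ.mapsTo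
  have hae : ∀ᵐ z, z ∈ Ω → divergence F (σ z) + divergence F z = 0 := by
    refine hΩ.ae_eq_zero_of_integral_contDiff_smul_eq_zero
      ((hdσ.add hd).locallyIntegrableOn hΩ.measurableSet) fun g hg hgc hgΩ => ?_
    have hg₁ : ContDiff ℝ 1 g := hg.of_le (by exact_mod_cast le_top)
    have hsum : ∀ z, g z • (divergence F (σ z) + divergence F z)
        = divergence F (σ z) * g z + divergence F z * g z := fun z => by
      rw [smul_eq_mul]; ring
    simp only [hsum]
    rw [integral_add (integrable_mul_of_tsupport_subset hdσ hg₁.continuous hgc hgΩ)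
      (integrable_mul_of_tsupport_subset hd hg₁.continuous hgc hgΩ),
      hσ.integral_divergence_comp_mul hΩ hF hμ hg₁ hgc hgΩ, neg_add_cancel]
  -- Nonempty open sets have positive measure, so continuity upgrades the a.e. identity to all of
  -- `Ω`.
  have heq := Measure.eqOn_open_of_ae_eq (g := fun _ => (0 : ℝ))
    ((ae_restrict_iff' hΩ.measurableSet).2 hae) hΩ (hdσ.add hd) continuousOn_const
  exact eq_neg_of_add_eq_zero_left (heq hz)

end Divergence

/-! ### Zeros of the divergence on arcs and at fixed points -/

theorem theorem1 (n : ℕ) (Ω : Set (EuclideanSpace ℝ (Fin n))) (hΩ : IsOpen Ω)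
    (hΩc : IsConnected Ω) (F : EuclideanSpace ℝ (Fin n) → EuclideanSpace ℝ (Fin n))
    (hF : ContDiffOn ℝ 1 F Ω) (σ : EuclideanSpace ℝ (Fin n) → EuclideanSpace ℝ (Fin n))
    (hσ : IsReversibility σ F Ω) (hμ : IsMeasurePreservingOn σ Ω) :
    (∀ z ∈ Ω, ∀ t : ℝ, (t, z) ∈ flowDomain F Ω → σ z = localFlow F Ω t z → σ z ≠ z →
      ∃ z₀ ∈ orbitArc F Ω t z, z₀ ∈ zeroDivergenceSet F Ω) ∧
    (∀ z ∈ Ω, σ z = z → F z ≠ 0 → z ∈ zeroDivergenceSet F Ω) := by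
  refine ⟨fun z hz t ⟨γ, hγ⟩ hσz _ => ?_, fun z hz hfix _ => ⟨hz, ?_⟩⟩
  · have hflow := hγ.localFlow_eqOn hΩ hF
    have hcont : ContinuousOn (fun s => divergence F (γ s)) (uIcc 0 t) :=
      (hF.continuousOn_divergence hΩ).comp hγ.isIntegralCurveOn.continuousOn hγ.mapsTo
    have hend : divergence F (γ t) = -divergence F (γ 0) := by
      have hγt : γ t = σ z := (hσz.trans (hflow right_mem_uIcc)).symm
      rw [hγt, hγ.initial, hσ.divergence_apply hΩ hF hμ hz]
    have hzero : (0 : ℝ) ∈ uIcc (divergence F (γ 0)) (divergence F (γ t)) := by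
      rw [hend, mem_uIcc]
      rcases le_total (divergence F (γ 0)) 0 with h | h
      · left; constructor <;> linarith
      · right; constructor <;> linarith
    obtain ⟨s, hs, hs0⟩ := intermediate_value_uIcc hcont hzero
    exact ⟨γ s, ⟨s, hs, hflow hs⟩, hγ.mapsTo hs, hs0⟩
  · have h := hσ.divergence_apply hΩ hF hμ hz
    rw [hfix] at h
    linarith
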